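/- Throughout, $\log$ is the logarithm to base $2$. Let $N\ge 1$ and $T\ge 2$, let $\mathcal X\subseteq\mathbb R^N$ be a nonempty compact convex set and $\mathcal Y\subseteq\mathbb R^N$ a bounded set, and put $\|\mathcal X\|_2=\sup_{x\in\mathcal X}\|x\|_2$, $\|\mathcal Y\|_2=\sup_{l\in\mathcal Y}\|l\|_2$. Let $\varepsilon>0$, $0<\delta<1$, $$\sigma=\max\Big\{\|\mathcal Y\|_2\sqrt{\tfrac{T}{\sqrt N\,\log T}},\ \tfrac{\sqrt N}{\varepsilon}\,\log T\,\log\tfrac{\log T}{\delta}\Big\},\qquad \mathcal D=\mathcal N(0,\sigma^2 I_N).$$ **Algorithm.** Fix independent draws from $\mathcal D$: $\xi_v$ for every node $v$ of the dyadic binary tree over the rounds, and $n_t^k$ for $0\le t<T$ and $k\ge1$. The node $v=(i,j)$ stands for the rounds $j2^i+1,\dots,(j+1)2^i$ and, once these are over, stores $\sum_{s=j2^i+1}^{(j+1)2^i} l_s+\xi_v$. For $0\le t<T$, let $\mathcal S_t$ be the minimum set of nodes that partitions the rounds $1,\dots,t$ (one node of size $2^i$ for each binary digit $2^i$ of $t$),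 and let $\tilde L_t$ be the sum of the values stored at the nodes of $\mathcal S_t$ plus the $\lceil\log T\rceil-|\mathcal S_t|$ fresh draws $n_t^1,n_t^2,\dots$ . In round $t=1,\dots,T$ the algorithm plays $x_t\in\operatorname{argmin}_{x\in\mathcal X}\langle x,\tilde L_{t-1}\rangle$, by a measurable argmin oracle with arbitrary tie-breaking, then observes $l_t\in\mathcal Y$ and suffers $\langle l_t,x_t\rangle$. **Claim.** (Regret) There is a universal constant $C>0$ such that, for all data as above and every $(l_1,\dots,l_T)\in\mathcal Y^T$, $$\mathbb E\Big[\sum_{t=1}^T\langle l_t,x_t\rangle-\min_{x\in\mathcal X}\sum_{t=1}^T\langle l_t,x\rangle\Big]\le C\Big(N^{1/4}\|\mathcal X\|_2\|\mathcal Y\|_2\sqrt T+\frac{N\|\mathcal X\|_2}{\varepsilon}\log^{1.5}T\,\log\frac{\log T}{\delta}\Big),$$ where the random variable on the left is integrable. (Privacy) Suppose moreover that $T\ge3$, that $\varepsilon\le1$, and that $\|\mathcal Y\|_2\le\sqrt N$ or, more generally, $\sigma\ge\frac{\|\mathcal Y\|_2}{\varepsilon}\log T\log\frac{\log T}{\delta}$.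 Then the algorithm is $(\varepsilon,\delta)$-differentially private: for all $L,L'\in\mathcal Y^T$ that differ in at most one vector and all measurable sets $S$ of sequences of $T$ predictions, $\mathbb P\big((x_1,\dots,x_T)(L)\in S\big)\le e^{\varepsilon}\,\mathbb P\big((x_1,\dots,x_T)(L')\in S\big)+\delta$. -/

import Mathlib

open MeasureTheory ProbabilityTheory

namespace DPOnline

/-- Points of `ℝ^N` with the Euclidean norm. -/
abbrev Vec (N : ℕ) := EuclideanSpace ℝ (Fin N)

/-- `‖S‖₂ = sup_{x ∈ S} ‖x‖₂` (used for bounded `S` only). -/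
noncomputable def setNorm {N : ℕ} (S : Set (Vec N)) : ℝ := sSup ((fun x => ‖x‖) '' S)

/-- An oracle for `argmin_{x ∈ X} ⟨x, v⟩`: a measurable choice of a minimiser for every `v`
(ties may be broken arbitrarily). -/
structure IsArgminOracle {N : ℕ} (X : Set (Vec N)) (oracle : Vec N → Vec N) : Prop where
  measurable : Measurable oracle
  mem : ∀ v, oracle v ∈ X
  le : ∀ v, ∀ y ∈ X, inner ℝ (oracle v) v ≤ inner ℝ y v

/-! ### Tree-based aggregation

Rounds are numbered `0, …, T - 1`, so that `t` is the number of losses observed before round `t`.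
The node `(i, j)` of the binary tree (level `i`, position `j`) stands for the `2 ^ i` consecutive
rounds `s` with `j * 2 ^ i ≤ s < (j + 1) * 2 ^ i`; it is populated once all of them are over. -/

/-- The rounds below the node `a` of the tree. -/
def nodeRounds (T : ℕ) (a : ℕ × ℕ) : Finset (Fin T) :=
  Finset.univ.filter fun s => a.2 * 2 ^ a.1 ≤ (s : ℕ) ∧ (s : ℕ) < (a.2 + 1) * 2 ^ a.1

/-- The minimum set of populated nodes which partitions the first `t` rounds: one node of level `i`
for each digit `1` at position `i` of the binary representation of `t`. -/
def prefixNodes (t : ℕ) : Finset (ℕ × ℕ) :=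
  ((Finset.range t.size).filter fun i => t.testBit i = true).image fun i => (i, t / 2 ^ i - 1)

/-- The indices of the independent noise vectors: `Sum.inl (i, j)` for the noise stored at the node
`(i, j)` of the tree, `Sum.inr (t, k)` for the `k`-th additional draw `n_t^k` made for the `t`-th
prefix sum. -/
abbrev NoiseIndex := (ℕ × ℕ) ⊕ (ℕ × ℕ)

/-- The noisy partial sum stored at the node `a`. -/
noncomputable def nodeValue {N T : ℕ} (l : Fin T → Vec N) (ω : NoiseIndex → Vec N)
    (a : ℕ × ℕ) : Vec N :=
  (∑ s ∈ nodeRounds T a, l s) + ω (Sum.inl a)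

/-- The estimate of the sum of the first `t` losses: the sum of the values stored at the nodes of
`prefixNodes t`, and as many fresh draws as bring the number of noise vectors to `⌈log₂ T⌉`.
For `t = 0` it consists of `⌈log₂ T⌉` fresh draws. -/
noncomputable def treeAgg {N T : ℕ} (l : Fin T → Vec N) (ω : NoiseIndex → Vec N)
    (t : ℕ) : Vec N :=
  (∑ a ∈ prefixNodes t, nodeValue l ω a) +
    ∑ k ∈ Finset.range (⌈Real.logb 2 T⌉₊ - (prefixNodes t).card), ω (Sum.inr (t, k))

/-- Follow-the-Perturbed-Leader over tree-based aggregation: the sequence of predictions made on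
the loss sequence `l` with noise `ω`. -/
noncomputable def ftpl {N T : ℕ} (oracle : Vec N → Vec N) (l : Fin T → Vec N)
    (ω : NoiseIndex → Vec N) : Fin T → Vec N :=
  fun t => oracle (treeAgg l ω t)

/-- The law of the noise: independent draws from `𝒩(0, σ² I_N)`. -/
noncomputable def gaussianNoise (N : ℕ) (σ : ℝ) : Measure (NoiseIndex → Vec N) :=
  Measure.infinitePi fun _ =>
    multivariateGaussian (0 : Vec N) (σ ^ 2 • (1 : Matrix (Fin N) (Fin N) ℝ))

/-! ### Regret and privacy -/

/-- `∑_t ⟨l_t, x_t⟩ - min_{x ∈ X} ∑_t ⟨l_t, x⟩` for given predictions `x`; the regret of a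
randomized algorithm is its expectation. -/
noncomputable def realizedRegret {N T : ℕ} (X : Set (Vec N)) (l x : Fin T → Vec N) : ℝ :=
  (∑ t, inner ℝ (l t) (x t)) - sInf ((fun y => ∑ t, inner ℝ (l t) y) '' X)

/-- `(ε, δ)`-differential privacy, on loss sequences in `Y`, of the algorithm which answers the loss
sequence `l` by the whole sequence of predictions `A l ω`, where `ω` is random with law `P`. -/
def IsDifferentiallyPrivate {N T : ℕ} {Ω : Type*} [MeasurableSpace Ω] (P : Measure Ω)
    (Y : Set (Vec N)) (A : (Fin T → Vec N) → Ω → (Fin T → Vec N)) (ε δ : ℝ) : Prop :=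
  ∀ l l' : Fin T → Vec N, (∀ t, l t ∈ Y) → (∀ t, l' t ∈ Y) →
    (∃ t₀, ∀ t, t ≠ t₀ → l t = l' t) →
    ∀ S : Set (Fin T → Vec N), MeasurableSet S →
      P {ω | A l ω ∈ S} ≤ ENNReal.ofReal (Real.exp ε) * P {ω | A l' ω ∈ S} + ENNReal.ofReal δ

/-- `σ = max {‖Y‖₂ √(T / (√N log T)), (√N / ε) log T log (log T / δ)}`, with logarithms to
base `2`. -/
noncomputable def noiseScale (N T : ℕ) (Y : Set (Vec N)) (ε δ : ℝ) : ℝ :=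
  max (setNorm Y * √(T / (√N * Real.logb 2 T)))
    (√N / ε * Real.logb 2 T * Real.logb 2 (Real.logb 2 T / δ))

end DPOnline

/-! Both halves rest on one fact: translating a Gaussian by `a` gives a law with log-density `W`
satisfying `E exp (p W) = exp (p (p - 1) r / 2)`, where `r` is the squared distance in units of the
standard deviation. The predicate `GaussianShift` retains just this. It is stable under products
(`r` adds up), and moments of `W` control both probabilities and expectations after the shift.

Privacy. Changing the loss of round `t₀` affects only the at most `⌈log T⌉` tree nodes above `t₀`,
and amounts to translating their noise by `l t₀ - l' t₀` (`ftpl_eq_shift`). So all predictions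
together are one function of a noise field and of its translate, with `r ≤ 4 ⌈log T⌉ ‖Y‖² / σ²`. The
excess `E (e^W - e^ε)₊` is bounded by a moment of order `1 + θ` (`GaussianShift.measure_le`); the
rest is a numerical choice of `θ` (`exists_privacy_parameters`).

Regret. The fresh draws bring every estimate to exactly `⌈log T⌉` noise vectors, so each is the true
prefix sum plus a vector of law `𝒩(0, v I)`, `v = ⌈log T⌉ σ²`. The losses are fixed in advance, so
expected regret depends only on these marginals, and a single `z` may replace the correlated
perturbations. With a common `z`, the leader that sees one loss ahead has regret at most `2 ‖X‖ ‖z‖`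
(`sum_be_the_leader_le`), and not seeing it costs `2 ‖X‖ ‖Y‖² / √v` per round, by the moment of
order two (`integral_inner_oracle_sub_le`). The given `σ` balances the two terms. -/

namespace DPOnline

/-! ### Infinite products with finitely many factors changed -/

section Product

variable {ι : Type*} {X : ι → Type*} [∀ i, MeasurableSpace (X i)]

lemma lintegral_infinitePi_prod (μ : ∀ i, Measure (X i)) [∀ i, IsProbabilityMeasure (μ i)]
    (F : Finset ι) {g : ∀ i, X i → ENNReal} (hg : ∀ i, Measurable (g i)) :
    ∫⁻ ω, ∏ i ∈ F, g i (ω i) ∂(Measure.infinitePi μ) = ∏ i ∈ F, ∫⁻ x, g i x ∂(μ i) := by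
  have hind : iIndepFun (fun i (ω : ∀ i, X i) => g i (ω i)) (Measure.infinitePi μ) :=
    iIndepFun_infinitePi fun i => hg i
  have h := lintegral_prod_eq_prod_lintegral_of_indepFun F _ hind
    (fun i => (hg i).comp (measurable_pi_apply i))
  rw [h]
  refine Finset.prod_congr rfl fun i _ => ?_
  rw [← (measurePreserving_eval_infinitePi μ i).lintegral_comp (hg i)]

/-- A product measure in which finitely many factors are replaced by ones with a density. -/
lemma infinitePi_eq_withDensity (μ ν : ∀ i, Measure (X i)) [∀ i, IsProbabilityMeasure (μ i)]
    [∀ i, IsProbabilityMeasure (ν i)] (F : Finset ι) {f : ∀ i, X i → ENNReal}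
    (hf : ∀ i, Measurable (f i)) (hF : ∀ i ∈ F, ν i = (μ i).withDensity (f i))
    (hFc : ∀ i ∉ F, ν i = μ i) :
    Measure.infinitePi ν = (Measure.infinitePi μ).withDensity fun ω => ∏ i ∈ F, f i (ω i) := by
  classical
  symm
  apply Measure.eq_infinitePi
  intro s t ht
  have hmeas : MeasurableSet (Set.pi (s : Set ι) t) :=
    MeasurableSet.pi s.countable_toSet fun i _ => ht i
  rw [withDensity_apply _ hmeas, ← lintegral_indicator hmeas]
  -- On a box, indicator times density factorises over the coordinates in `s ∪ F`, so independence
  -- applies.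
  have key : ∀ ω : ∀ i, X i, (Set.pi (s : Set ι) t).indicator (fun ω => ∏ i ∈ F, f i (ω i)) ω =
      ∏ i ∈ s ∪ F, ((if i ∈ s then (t i).indicator 1 (ω i) else 1) *
        (if i ∈ F then f i (ω i) else 1)) := by
    intro ω
    rw [Finset.prod_mul_distrib, Finset.prod_ite_mem, Finset.prod_ite_mem,
      Finset.inter_eq_right.2 Finset.subset_union_left,
      Finset.inter_eq_right.2 Finset.subset_union_right]
    by_cases h : ω ∈ Set.pi (s : Set ι) t
    · rw [Set.indicator_of_mem h, Finset.prod_eq_one (s := s), one_mul]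
      intro i hi
      rw [Set.indicator_of_mem (h i hi)]; rfl
    · rw [Set.indicator_of_notMem h]
      simp only [Set.mem_pi, not_forall] at h
      obtain ⟨i, hi, hit⟩ := h
      rw [Finset.prod_eq_zero (i := i) hi (Set.indicator_of_notMem hit _), zero_mul]
  simp_rw [key]
  rw [lintegral_infinitePi_prod μ (s ∪ F) (g := fun i x =>
    (if i ∈ s then (t i).indicator 1 x else 1) * (if i ∈ F then f i x else 1))]
  -- A coordinate that the box leaves free contributes the total mass of `ν i`.
  · have hone : ∀ i ∈ s ∪ F, i ∉ s → (∫⁻ x, (if i ∈ s then (t i).indicator 1 x else 1) *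
        (if i ∈ F then f i x else 1) ∂(μ i)) = 1 := by
      intro i hi his
      have hiF : i ∈ F := by simpa [his] using hi
      have := measure_univ (μ := ν i)
      rw [hF i hiF, withDensity_apply _ .univ] at this
      simpa [his, hiF] using this
    rw [← Finset.prod_subset Finset.subset_union_left hone]
    refine Finset.prod_congr rfl fun i hi => ?_
    by_cases hiF : i ∈ F
    · rw [hF i hiF, withDensity_apply _ (ht i), ← lintegral_indicator (ht i)]
      refine lintegral_congr fun x => ?_
      by_cases hx : x ∈ t i <;> simp [hi, hiF, hx]
    · rw [hFc i hiF]
      simp [hi, hiF, lintegral_indicator_one (ht i)]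
  · intro i
    refine Measurable.mul ?_ ?_
    · split_ifs
      · exact measurable_one.indicator (ht i)
      · exact measurable_const
    · split_ifs
      · exact hf i
      · exact measurable_const

end Product

/-! ### Translations of Gaussians through the moments of their log-density -/

lemma sq_integral_le {Ω : Type*} [MeasurableSpace Ω] {P : Measure Ω} [IsProbabilityMeasure P]
    {f : Ω → ℝ} (hf : Integrable f P) (hf2 : Integrable (fun x => f x ^ 2) P) :
    (∫ x, f x ∂P) ^ 2 ≤ ∫ x, f x ^ 2 ∂P := by
  set m := ∫ x, f x ∂P with hm
  have h0 : 0 ≤ ∫ x, (f x - m) ^ 2 ∂P := integral_nonneg fun x => sq_nonneg _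
  have e : ∀ x, (f x - m) ^ 2 = f x ^ 2 - 2 * m * f x + m ^ 2 := fun x => by ring
  simp_rw [e] at h0
  rw [integral_add (by exact hf2.sub (hf.const_mul (2 * m))) (integrable_const _),
    integral_sub hf2 (hf.const_mul _), integral_const_mul, ← hm] at h0
  simp at h0
  nlinarith

/-- `Q` has a log-density `W` with respect to `P` whose exponential moments are those of
the log-density between two Gaussians with identity covariance, at squared distance `r`. -/
def GaussianShift {Ω : Type*} [MeasurableSpace Ω] (P Q : Measure Ω) (r : ℝ) : Prop :=
  ∃ W : Ω → ℝ, Measurable W ∧ Q = P.withDensity (fun x => ENNReal.ofReal (Real.exp (W x))) ∧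
    ∀ p : ℝ, ∫⁻ x, ENNReal.ofReal (Real.exp (p * W x)) ∂P =
      ENNReal.ofReal (Real.exp (p * (p - 1) * r / 2))

lemma gaussianShift_gaussianReal (a : ℝ) {v : NNReal} (hv : v ≠ 0) :
    GaussianShift (gaussianReal 0 v) (gaussianReal a v) (a ^ 2 / v) := by
  have hv' : (v : ℝ) ≠ 0 := by exact_mod_cast hv
  refine ⟨fun x => (a * x - a ^ 2 / 2) / v, by fun_prop, ?_, fun p => ?_⟩
  · rw [gaussianReal_of_var_ne_zero _ hv, gaussianReal_of_var_ne_zero _ hv,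
      ← withDensity_mul _ (measurable_gaussianPDF _ _) (by fun_prop)]
    congr 1
    ext x
    simp only [gaussianPDF, Pi.mul_apply]
    rw [← ENNReal.ofReal_mul (gaussianPDFReal_nonneg _ _ _)]
    congr 1
    rw [gaussianPDFReal, gaussianPDFReal, mul_assoc _ (Real.exp _), ← Real.exp_add]
    congr 2
    field_simp
    ring
  · have hint := integrable_exp_mul_gaussianReal (μ := 0) (v := v) (p * a / v)
    have hm := congrFun (mgf_fun_id_gaussianReal (μ := 0) (v := v)) (p * a / v)
    rw [mgf] at hm
    have e : ∀ x : ℝ, Real.exp (p * ((a * x - a ^ 2 / 2) / v)) =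
        Real.exp (p * a / v * x) * Real.exp (-(p * a ^ 2 / 2 / v)) := by
      intro x
      rw [← Real.exp_add]; congr 1; field_simp; ring
    simp_rw [e]
    rw [← ofReal_integral_eq_lintegral_ofReal (hint.mul_const _)
      (Filter.Eventually.of_forall fun x => by positivity), integral_mul_const, hm,
      ← Real.exp_add]
    congr 2
    field_simp
    ring

namespace GaussianShift

variable {Ω : Type*} [MeasurableSpace Ω] {P Q : Measure Ω} {r : ℝ}

lemma map {Ω' : Type*} [MeasurableSpace Ω'] (h : GaussianShift P Q r) (e : Ω ≃ᵐ Ω') :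
    GaussianShift (P.map e) (Q.map e) r := by
  obtain ⟨W, hW, hQ, hp⟩ := h
  refine ⟨W ∘ e.symm, hW.comp e.symm.measurable, ?_, fun p => ?_⟩
  · ext s hs
    rw [e.map_apply, hQ, withDensity_apply _ (e.measurable hs), withDensity_apply _ hs,
      e.restrict_map, lintegral_map_equiv]
    simp
  · rw [lintegral_map_equiv, ← hp p]
    simp

/-- The log-density of a product is a sum of independent terms, so exponential moments multiply and
the exponents `r i` add. -/
lemma infinitePi {ι : Type*} {X : ι → Type*} [∀ i, MeasurableSpace (X i)]
    (μ ν : ∀ i, Measure (X i)) [∀ i, IsProbabilityMeasure (μ i)]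
    [∀ i, IsProbabilityMeasure (ν i)] (F : Finset ι) (r : ι → ℝ)
    (h : ∀ i ∈ F, GaussianShift (μ i) (ν i) (r i)) (hF : ∀ i ∉ F, ν i = μ i) :
    GaussianShift (Measure.infinitePi μ) (Measure.infinitePi ν) (∑ i ∈ F, r i) := by
  classical
  have h' : ∀ i, ∃ W : X i → ℝ, Measurable W ∧ (i ∈ F →
      (ν i = (μ i).withDensity (fun x => ENNReal.ofReal (Real.exp (W x))) ∧
      ∀ p : ℝ, ∫⁻ x, ENNReal.ofReal (Real.exp (p * W x)) ∂(μ i) =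
        ENNReal.ofReal (Real.exp (p * (p - 1) * r i / 2)))) := by
    intro i
    by_cases hi : i ∈ F
    · obtain ⟨W, hW, h1, h2⟩ := h i hi
      exact ⟨W, hW, fun _ => ⟨h1, h2⟩⟩
    · exact ⟨0, measurable_zero, fun h => absurd h hi⟩
  choose W hW hWF using h'
  have hmeas : ∀ (p : ℝ) i, Measurable fun x => ENNReal.ofReal (Real.exp (p * W i x)) :=
    fun p i => (((hW i).const_mul p).exp).ennreal_ofReal
  have e : ∀ (p : ℝ) (ω : ∀ i, X i), ENNReal.ofReal (Real.exp (p * ∑ i ∈ F, W i (ω i))) =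
      ∏ i ∈ F, ENNReal.ofReal (Real.exp (p * W i (ω i))) := by
    intro p ω
    rw [Finset.mul_sum, Real.exp_sum, ENNReal.ofReal_prod_of_nonneg fun _ _ => by positivity]
  refine ⟨fun ω => ∑ i ∈ F, W i (ω i), ?_, ?_, fun p => ?_⟩
  · exact Finset.measurable_sum _ fun i _ => (hW i).comp (measurable_pi_apply i)
  · rw [infinitePi_eq_withDensity μ ν F (f := fun i x => ENNReal.ofReal (Real.exp (W i x)))
      (fun i => by simpa using hmeas 1 i) (fun i hi => (hWF i hi).1) hF]
    congr 1
    ext ω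
    simpa using (e 1 ω).symm
  · simp_rw [e]
    rw [lintegral_infinitePi_prod μ F (hmeas p), Finset.prod_congr rfl fun i hi => (hWF i hi).2 p,
      ← ENNReal.ofReal_prod_of_nonneg fun _ _ => by positivity, ← Real.exp_sum]
    congr 2
    rw [Finset.mul_sum, Finset.sum_div]

lemma isProbabilityMeasure_left (h : GaussianShift P Q r) : IsProbabilityMeasure P := by
  obtain ⟨W, -, -, hp⟩ := h
  exact ⟨by simpa using hp 0⟩

lemma isProbabilityMeasure_right (h : GaussianShift P Q r) : IsProbabilityMeasure Q := by
  obtain ⟨W, -, hQ, hp⟩ := h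
  refine ⟨?_⟩
  rw [hQ, withDensity_apply _ .univ, Measure.restrict_univ]
  simpa using hp 1

/-- The privacy loss of a Gaussian shift, from its moment of order `1 + θ`. -/
lemma measure_le (h : GaussianShift P Q r) {ε θ τ c : ℝ} (hc : 0 ≤ c) (hτ : τ ≤ θ)
    (hcτ : ∀ u, 0 ≤ u → 1 - Real.exp (-u) ≤ c * Real.exp (τ * u)) {B : Set Ω}
    (hB : MeasurableSet B) :
    Q B ≤ ENNReal.ofReal (Real.exp ε) * P B +
      ENNReal.ofReal (c * Real.exp (-θ * ε + θ * (1 + θ) * r / 2)) := by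
  obtain ⟨W, hW, hQ, hp⟩ := h
  -- Where `W ≥ ε`, write `e^W - e^ε = e^W (1 - e^{-u})` with `u = W - ε` and bound the last factor
  -- by `c e^{θ u}`.
  have key : ∀ x, ENNReal.ofReal (Real.exp (W x)) ≤ ENNReal.ofReal (Real.exp ε) +
      ENNReal.ofReal (c * Real.exp (-θ * ε)) * ENNReal.ofReal (Real.exp ((1 + θ) * W x)) := by
    intro x
    rw [← ENNReal.ofReal_mul (by positivity), ← ENNReal.ofReal_add (by positivity) (by positivity)]
    refine ENNReal.ofReal_le_ofReal ?_
    rcases le_total (W x) ε with hx | hx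
    · exact (Real.exp_le_exp.2 hx).trans (le_add_of_nonneg_right (by positivity))
    · have h1 := hcτ (W x - ε) (sub_nonneg.2 hx)
      have h2 : Real.exp (τ * (W x - ε)) ≤ Real.exp (θ * (W x - ε)) :=
        Real.exp_le_exp.2 (mul_le_mul_of_nonneg_right hτ (sub_nonneg.2 hx))
      have h3 := mul_le_mul_of_nonneg_left (h1.trans (mul_le_mul_of_nonneg_left h2 hc))
        (Real.exp_pos (W x)).le
      have h4 : Real.exp (W x) * Real.exp (-(W x - ε)) = Real.exp ε := by
        rw [← Real.exp_add]; congr 1; ring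
      have h5 : Real.exp (W x) * (c * Real.exp (θ * (W x - ε))) =
          c * Real.exp (-θ * ε) * Real.exp ((1 + θ) * W x) := by
        rw [mul_left_comm, mul_assoc, ← Real.exp_add, ← Real.exp_add]; congr 2; ring
      rw [mul_sub, mul_one, h4, h5] at h3
      linarith
  rw [hQ, withDensity_apply _ hB]
  calc ∫⁻ x in B, ENNReal.ofReal (Real.exp (W x)) ∂P
      ≤ ∫⁻ x in B, (ENNReal.ofReal (Real.exp ε) + ENNReal.ofReal (c * Real.exp (-θ * ε)) *
          ENNReal.ofReal (Real.exp ((1 + θ) * W x))) ∂P := lintegral_mono key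
    _ = ENNReal.ofReal (Real.exp ε) * P B + ∫⁻ x in B, (ENNReal.ofReal (c * Real.exp (-θ * ε)) *
          ENNReal.ofReal (Real.exp ((1 + θ) * W x))) ∂P := by
        rw [lintegral_add_left measurable_const, setLIntegral_const]
    _ ≤ ENNReal.ofReal (Real.exp ε) * P B + ∫⁻ x, (ENNReal.ofReal (c * Real.exp (-θ * ε)) *
          ENNReal.ofReal (Real.exp ((1 + θ) * W x))) ∂P := by
        exact add_le_add le_rfl (setLIntegral_le_lintegral _ _)
    _ = _ := by
        rw [lintegral_const_mul _ (((hW.const_mul (1 + θ)).exp).ennreal_ofReal), hp,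
          ← ENNReal.ofReal_mul (by positivity), mul_assoc, ← Real.exp_add]
        congr 4
        ring

/-- Expectations of a bounded function under a Gaussian shift, from the moment of order `2`. -/
lemma abs_integral_sub_le (h : GaussianShift P Q r) (hr : 0 ≤ r) {g : Ω → ℝ} (hg : Measurable g)
    {M : ℝ} (hM : ∀ x, |g x| ≤ M) : |∫ x, g x ∂Q - ∫ x, g x ∂P| ≤ 2 * M * √r := by
  have := h.isProbabilityMeasure_left
  have := h.isProbabilityMeasure_right
  have hM0 : 0 ≤ M := by
    obtain ⟨x⟩ := P.nonempty_of_neZero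
    exact (abs_nonneg _).trans (hM x)
  -- For `r ≥ 1` the trivial bound `2 M` suffices. For `r ≤ 1`, `(E |e^W - 1|)² ≤ e^r - 1 ≤ 2 r`.
  rcases le_total 1 r with hr1 | hr1
  · have hb : ∀ (μ : Measure Ω) [IsProbabilityMeasure μ], |∫ x, g x ∂μ| ≤ M := by
      intro μ _
      simpa using norm_integral_le_of_norm_le_const (μ := μ) (f := g)
        (Filter.Eventually.of_forall hM)
    have h1 : 1 ≤ √r := Real.one_le_sqrt.2 hr1
    calc _ ≤ |(∫ x, g x ∂Q)| + |(∫ x, g x ∂P)| := abs_sub _ _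
      _ ≤ M + M := add_le_add (hb Q) (hb P)
      _ ≤ 2 * M * √r := by nlinarith
  obtain ⟨W, hW, hQ, hp⟩ := h
  have hint : ∀ p : ℝ, Integrable (fun x => Real.exp (p * W x)) P := by
    intro p
    refine ⟨((hW.const_mul p).exp).aestronglyMeasurable, ?_⟩
    rw [hasFiniteIntegral_iff_ofReal (Filter.Eventually.of_forall fun x => by positivity), hp]
    exact ENNReal.ofReal_lt_top
  have hval : ∀ p : ℝ, ∫ x, Real.exp (p * W x) ∂P = Real.exp (p * (p - 1) * r / 2) := by
    intro p
    rw [integral_eq_lintegral_of_nonneg_ae (Filter.Eventually.of_forall fun x => by positivity)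
      (hint p).1, hp, ENNReal.toReal_ofReal (by positivity)]
  have hi1 : Integrable (fun x => Real.exp (W x)) P := by simpa using hint 1
  have hv1 : ∫ x, Real.exp (W x) ∂P = 1 := by simpa using hval 1
  have hd : Integrable (fun x => Real.exp (W x) - 1) P := hi1.sub (integrable_const 1)
  have hsq : ∀ x, |Real.exp (W x) - 1| ^ 2 = Real.exp (2 * W x) - 2 * Real.exp (W x) + 1 := by
    intro x
    rw [sq_abs, two_mul, Real.exp_add]; ring
  have hi2 : Integrable (fun x => |Real.exp (W x) - 1| ^ 2) P := by
    simp_rw [hsq]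
    exact ((hint 2).sub (hi1.const_mul 2)).add (integrable_const 1)
  have hv2 : ∫ x, |Real.exp (W x) - 1| ^ 2 ∂P = Real.exp r - 1 := by
    simp_rw [hsq]
    rw [integral_add (by exact (hint 2).sub (hi1.const_mul 2)) (integrable_const 1),
      integral_sub (hint 2) (hi1.const_mul 2), integral_const_mul, hv1, hval 2]
    simp
    ring_nf
  set m := ∫ x, |Real.exp (W x) - 1| ∂P with hm
  have hm2 : m ^ 2 ≤ Real.exp r - 1 := by
    rw [← hv2]
    exact sq_integral_le hd.abs hi2
  have hexp : Real.exp r - 1 ≤ 2 * r := by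
    have := (abs_le.1 (Real.abs_exp_sub_one_sub_id_le (x := r) (by rwa [abs_of_nonneg hr]))).2
    nlinarith
  have hm3 : m ≤ 2 * √r := by
    refine abs_le_of_sq_le_sq' ?_ (by positivity) |>.2
    rw [mul_pow, Real.sq_sqrt hr]
    linarith
  have hQi : ∫ x, g x ∂Q = ∫ x, Real.exp (W x) * g x ∂P := by
    rw [hQ, integral_withDensity_eq_integral_toReal_smul (hW.exp.ennreal_ofReal)
      (Filter.Eventually.of_forall fun x => ENNReal.ofReal_lt_top)]
    refine integral_congr_ae (Filter.Eventually.of_forall fun x => ?_)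
    simp [ENNReal.toReal_ofReal (Real.exp_pos _).le]
  have hgi : Integrable g P := Integrable.of_bound hg.aestronglyMeasurable M
    (Filter.Eventually.of_forall hM)
  have hegi : Integrable (fun x => Real.exp (W x) * g x) P :=
    hi1.mul_bdd (c := M) hg.aestronglyMeasurable (Filter.Eventually.of_forall hM)
  rw [hQi, ← integral_sub hegi hgi]
  calc |∫ x, (Real.exp (W x) * g x - g x) ∂P| ≤ ∫ x, |Real.exp (W x) * g x - g x| ∂P :=
        abs_integral_le_integral_abs
    _ ≤ ∫ x, |Real.exp (W x) - 1| * M ∂P := by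
        refine integral_mono (hegi.sub hgi).abs (hd.abs.mul_const M) fun x => ?_
        have : Real.exp (W x) * g x - g x = (Real.exp (W x) - 1) * g x := by ring
        simp only [this, abs_mul]
        exact mul_le_mul_of_nonneg_left (hM x) (abs_nonneg _)
    _ = m * M := integral_mul_const _ _
    _ ≤ 2 * M * √r := by nlinarith

end GaussianShift

/-! ### The law `𝒩(0, v I)` on Euclidean space -/

section IsotropicGaussian

variable {N : ℕ}

/-- The Gaussian law `𝒩(0, v I_N)`. -/
noncomputable abbrev isoGaussian (N : ℕ) (v : ℝ) : Measure (Vec N) :=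
  multivariateGaussian (0 : Vec N) (v • (1 : Matrix (Fin N) (Fin N) ℝ))

lemma posSemidef_smul_one {v : ℝ} (hv : 0 ≤ v) :
    (v • (1 : Matrix (Fin N) (Fin N) ℝ)).PosSemidef :=
  Matrix.PosSemidef.one.smul hv

lemma charFun_isoGaussian {v : ℝ} (hv : 0 ≤ v) (t : Vec N) :
    charFun (isoGaussian N v) t = Complex.exp (-(v * ‖t‖ ^ 2 / 2 : ℝ)) := by
  rw [isoGaussian, charFun_multivariateGaussian (posSemidef_smul_one hv)]
  congr 1
  rw [Matrix.smul_mulVec, Matrix.one_mulVec, dotProduct_smul, EuclideanSpace.real_norm_sq_eq]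
  simp [dotProduct, pow_two]

lemma isoGaussian_eq_map (v : NNReal) :
    isoGaussian N v = (Measure.infinitePi fun _ : Fin N => gaussianReal 0 v).map
      (MeasurableEquiv.toLp 2 (Fin N → ℝ)) := by
  rw [Measure.infinitePi_eq_pi]
  apply Measure.ext_of_charFun (E := EuclideanSpace ℝ (Fin N))
  ext t
  rw [charFun_isoGaussian v.coe_nonneg]
  have := charFun_pi (μ := fun _ : Fin N => gaussianReal 0 v) t
  rw [MeasurableEquiv.coe_toLp, this]
  simp_rw [charFun_gaussianReal, ← Complex.exp_sum, EuclideanSpace.real_norm_sq_eq]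
  simp [Finset.mul_sum, Finset.sum_div]

lemma gaussianShift_isoGaussian (a : Vec N) {v : ℝ} (hv : 0 < v) :
    GaussianShift (isoGaussian N v) ((isoGaussian N v).map (· + a)) (‖a‖ ^ 2 / v) := by
  lift v to NNReal using hv.le
  have hv' : v ≠ 0 := by rintro rfl; simp at hv
  have hmap : (isoGaussian N v).map (· + a) =
      (Measure.infinitePi fun i : Fin N => gaussianReal (a i) v).map
        (MeasurableEquiv.toLp 2 (Fin N → ℝ)) := by
    have : (fun i : Fin N => gaussianReal (a i) v) =
        fun i => (gaussianReal 0 v).map (fun x => x + a i) := by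
      ext1 i
      rw [gaussianReal_map_add_const, zero_add]
    rw [isoGaussian_eq_map, Measure.map_map (measurable_add_const a) (MeasurableEquiv.measurable _),
      this, ← Measure.infinitePi_map_pi _ (fun i => measurable_add_const (a i)),
      Measure.map_map (MeasurableEquiv.measurable _) (by fun_prop)]
    rfl
  rw [hmap, isoGaussian_eq_map, EuclideanSpace.real_norm_sq_eq, Finset.sum_div]
  exact (GaussianShift.infinitePi _ _ Finset.univ _
    (fun i _ => gaussianShift_gaussianReal (a i) hv') (by simp)).map _

lemma memLp_two_isoGaussian (v : ℝ) : MemLp id 2 (isoGaussian N v) := IsGaussian.memLp_two_id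

lemma integral_norm_isoGaussian_le {v : ℝ} (hv : 0 ≤ v) :
    ∫ x, ‖x‖ ∂(isoGaussian N v) ≤ √(N * v) := by
  have hL := memLp_two_isoGaussian (N := N) v
  have hi : Integrable (fun x : Vec N => ‖x‖) (isoGaussian N v) :=
    (hL.integrable (by norm_num)).norm
  have hi2 : Integrable (fun x : Vec N => ‖x‖ ^ 2) (isoGaussian N v) :=
    hL.integrable_norm_pow (by norm_num)
  have hc : ∀ i : Fin N, Integrable (fun x : Vec N => x i ^ 2) (isoGaussian N v) := by
    intro i
    refine hi2.mono' (by fun_prop) (Filter.Eventually.of_forall fun x => ?_)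
    rw [Real.norm_eq_abs, abs_of_nonneg (sq_nonneg _), EuclideanSpace.real_norm_sq_eq]
    exact Finset.single_le_sum (f := fun i => x i ^ 2) (fun _ _ => sq_nonneg _) (Finset.mem_univ i)
  have hv2 : ∫ x, ‖x‖ ^ 2 ∂(isoGaussian N v) = N * v := by
    simp_rw [EuclideanSpace.real_norm_sq_eq]
    rw [integral_finsetSum _ fun i _ => hc i]
    have : ∀ i : Fin N, ∫ x, x i ^ 2 ∂(isoGaussian N v) = v := by
      intro i
      have h := measurePreserving_eval_multivariateGaussian (μ := (0 : Vec N))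
        (posSemidef_smul_one (N := N) hv) (i := i)
      have h2 := variance_eval_multivariateGaussian (μ := (0 : Vec N))
        (posSemidef_smul_one (N := N) hv) i
      have h3 : ∫ x : Vec N, x i ∂(isoGaussian N v) = 0 := by
        have := integral_map (μ := isoGaussian N v) (φ := fun x : Vec N => x i)
          h.measurable.aemeasurable (f := fun y : ℝ => y) (by fun_prop)
        rw [← this, h.map_eq, integral_id_gaussianReal]
        simp
      rw [variance_of_integral_eq_zero h.measurable.aemeasurable h3] at h2
      simpa using h2
    simp [this]
  exact Real.le_sqrt_of_sq_le (hv2 ▸ sq_integral_le hi hi2)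

end IsotropicGaussian

/-! ### Dyadic decomposition of prefixes and the effect of one loss -/

section Tree

variable {N T : ℕ}

/-- The sum of the first `t` losses. -/
noncomputable def prefixSum (l : Fin T → Vec N) (t : ℕ) : Vec N :=
  ∑ s ∈ Finset.univ.filter (fun s : Fin T => (s : ℕ) < t), l s

lemma prefixSum_zero (l : Fin T → Vec N) : prefixSum l 0 = 0 := by simp [prefixSum]

lemma prefixSum_succ (l : Fin T → Vec N) (t : Fin T) :
    prefixSum l (t + 1) = prefixSum l t + l t := by
  have : Finset.univ.filter (fun s : Fin T => (s : ℕ) < t + 1) =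
      insert t (Finset.univ.filter (fun s : Fin T => (s : ℕ) < t)) := by
    ext s
    simp [Fin.ext_iff]
    omega
  rw [prefixSum, this, Finset.sum_insert (by simp), add_comm, prefixSum]

lemma prefixSum_self (l : Fin T → Vec N) : prefixSum l T = ∑ t, l t := by
  simp [prefixSum]

lemma sum_nodeRounds (l : Fin T → Vec N) (a : ℕ × ℕ) :
    ∑ s ∈ nodeRounds T a, l s =
      prefixSum l ((a.2 + 1) * 2 ^ a.1) - prefixSum l (a.2 * 2 ^ a.1) := by
  have hle : a.2 * 2 ^ a.1 ≤ (a.2 + 1) * 2 ^ a.1 := Nat.mul_le_mul_right _ (Nat.le_succ _)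
  rw [eq_sub_iff_add_eq, prefixSum, prefixSum, ← Finset.sum_union]
  · refine Finset.sum_congr ?_ fun _ _ => rfl
    ext s
    simp [nodeRounds]
    omega
  · rw [Finset.disjoint_left]
    intro s hs hs'
    simp [nodeRounds] at hs hs'
    omega

lemma sum_prefixNodes_apply {M : Type*} [AddCommMonoid M] (f : ℕ × ℕ → M) (t : ℕ) :
    ∑ a ∈ prefixNodes t, f a =
      ∑ i ∈ Finset.range t.size, if t.testBit i = true then f (i, t / 2 ^ i - 1) else 0 := by
  rw [prefixNodes, Finset.sum_image, Finset.sum_filter]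
  intro i _ j _ h
  exact (Prod.ext_iff.1 h).1

lemma sum_prefixNodes (l : Fin T → Vec N) (t : ℕ) :
    ∑ a ∈ prefixNodes t, ∑ s ∈ nodeRounds T a, l s = prefixSum l t := by
  rw [sum_prefixNodes_apply]
  -- The sum telescopes over the truncations of `t` to its binary digits from position `i` upwards:
  -- a digit `1` removes exactly one node, a digit `0` changes nothing.
  have key : ∀ i, (if t.testBit i = true then ∑ s ∈ nodeRounds T (i, t / 2 ^ i - 1), l s else 0) =
      prefixSum l (t / 2 ^ i * 2 ^ i) - prefixSum l (t / 2 ^ (i + 1) * 2 ^ (i + 1)) := by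
    intro i
    have hdiv : t / 2 ^ (i + 1) = t / 2 ^ i / 2 := by rw [Nat.div_div_eq_div_mul, pow_succ]
    have hbit : t.testBit i = true ↔ t / 2 ^ i % 2 = 1 := by
      simp [Nat.testBit_eq_decide_div_mod_eq]
    simp only [hbit, sum_nodeRounds]
    rw [hdiv, pow_succ, mul_comm (2 ^ i) 2, ← mul_assoc]
    generalize t / 2 ^ i = q
    split_ifs with h
    · rw [show q - 1 + 1 = q by omega, show q / 2 * 2 = q - 1 by omega]
    · rw [show q / 2 * 2 = q by omega, sub_self]
  simp_rw [key]
  rw [Finset.sum_range_sub', Nat.div_eq_of_lt t.lt_size_self]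
  simp [prefixSum_zero]

lemma fst_lt_of_mem_prefixNodes {t : ℕ} {a : ℕ × ℕ} (ha : a ∈ prefixNodes t) : a.1 < t.size := by
  simp only [prefixNodes, Finset.mem_image, Finset.mem_filter, Finset.mem_range] at ha
  obtain ⟨i, hi, rfl⟩ := ha
  exact hi.1

lemma card_prefixNodes_le (t : ℕ) : (prefixNodes t).card ≤ t.size :=
  (Finset.card_image_le.trans (Finset.card_filter_le _ _)).trans (by simp)

lemma size_le_ceil_logb {t T : ℕ} (ht : t < T) : t.size ≤ ⌈Real.logb 2 T⌉₊ := by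
  rw [Nat.size_le]
  have h1 : (T : ℝ) ≤ 2 ^ (⌈Real.logb 2 T⌉₊ : ℝ) :=
    (Real.logb_le_iff_le_rpow (by norm_num) (by exact_mod_cast (Nat.zero_le t).trans_lt ht)).1
      (Nat.le_ceil _)
  rw [Real.rpow_natCast] at h1
  exact ht.trans_le (by exact_mod_cast h1)

/-- The noise vectors which enter the estimate of the sum of the first `t` losses. -/
noncomputable def noiseIndices (T t : ℕ) : Finset NoiseIndex :=
  (prefixNodes t).disjSum
    ((Finset.range (⌈Real.logb 2 T⌉₊ - (prefixNodes t).card)).map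
      ⟨Prod.mk t, Prod.mk_right_injective t⟩)

/-- Because `t < T ≤ 2 ^ ⌈log T⌉`, the natural subtraction in the padding never truncates. The count
is the same in all rounds, which lets one perturbation serve them all. -/
lemma card_noiseIndices {t : ℕ} (ht : t < T) :
    (noiseIndices T t).card = ⌈Real.logb 2 T⌉₊ := by
  have := (card_prefixNodes_le t).trans (size_le_ceil_logb ht)
  rw [noiseIndices, Finset.card_disjSum, Finset.card_map, Finset.card_range]
  omega

lemma treeAgg_eq (l : Fin T → Vec N) (ω : NoiseIndex → Vec N) (t : ℕ) :
    treeAgg l ω t = prefixSum l t + ∑ i ∈ noiseIndices T t, ω i := by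
  simp only [treeAgg, nodeValue, noiseIndices, Finset.sum_disjSum, Finset.sum_map,
    Finset.sum_add_distrib, sum_prefixNodes, Function.Embedding.coeFn_mk, add_assoc]

/-- The tree nodes above the round `t` on the first `m` levels. -/
def ancestors (m t : ℕ) : Finset NoiseIndex :=
  (Finset.range m).image fun i => Sum.inl (i, t / 2 ^ i)

lemma card_ancestors_le (m t : ℕ) : (ancestors m t).card ≤ m :=
  Finset.card_image_le.trans (by simp)

lemma inl_mem_ancestors {m t : ℕ} {a : ℕ × ℕ} :
    Sum.inl a ∈ ancestors m t ↔ a.1 < m ∧ t / 2 ^ a.1 = a.2 := by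
  obtain ⟨i, j⟩ := a
  simp only [ancestors, Finset.mem_image, Finset.mem_range, Sum.inl.injEq, Prod.mk.injEq]
  constructor
  · rintro ⟨i', h, rfl, h'⟩
    exact ⟨h, h'⟩
  · rintro ⟨h, h'⟩
    exact ⟨i, h, rfl, h'⟩

lemma inr_notMem_ancestors {m t : ℕ} {a : ℕ × ℕ} : Sum.inr a ∉ ancestors m t := by
  simp [ancestors]

/-- Changing one loss has the same effect on the predictions as shifting the noise at the nodes
above it. -/
lemma ftpl_eq_shift (oracle : Vec N → Vec N) {l l' : Fin T → Vec N} {t₀ : Fin T}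
    (hl : ∀ t, t ≠ t₀ → l t = l' t) (ω : NoiseIndex → Vec N) :
    ftpl oracle l ω = ftpl oracle l' fun i => ω i +
      if i ∈ ancestors ⌈Real.logb 2 T⌉₊ t₀ then l t₀ - l' t₀ else 0 := by
  ext1 t
  simp only [ftpl]
  congr 1
  simp only [treeAgg, inr_notMem_ancestors, if_false, add_zero]
  congr 1
  refine Finset.sum_congr rfl fun a ha => ?_
  have ha' := (fst_lt_of_mem_prefixNodes ha).trans_le (size_le_ceil_logb t.2)
  -- Nodes used by a prefix lie below level `⌈log T⌉`, so restricting the ancestors to those levels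
  -- loses none of them.
  have hmem : Sum.inl a ∈ ancestors ⌈Real.logb 2 T⌉₊ t₀ ↔ t₀ ∈ nodeRounds T a := by
    rw [inl_mem_ancestors, nodeRounds, Finset.mem_filter,
      Nat.div_eq_iff (by positivity : 0 < 2 ^ a.1)]
    have : 0 < 2 ^ a.1 := by positivity
    simp only [ha', true_and, Finset.mem_univ, add_mul, one_mul]
    omega
  have hsum : ∑ s ∈ nodeRounds T a, l s = ∑ s ∈ nodeRounds T a, l' s +
      if t₀ ∈ nodeRounds T a then l t₀ - l' t₀ else 0 := by
    rw [← sub_eq_iff_eq_add', ← Finset.sum_sub_distrib]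
    rw [← Finset.sum_ite_eq (nodeRounds T a) t₀ (fun s => l s - l' s)]
    refine Finset.sum_congr rfl fun s _ => ?_
    split_ifs with h
    · rfl
    · rw [hl s (Ne.symm h), sub_self]
  simp only [nodeValue, hmem, hsum]
  abel

end Tree

/-! ### The noise field: its sums and its translates -/

section Noise

variable {N : ℕ}

instance (σ : ℝ) : IsProbabilityMeasure (gaussianNoise N σ) := by
  unfold gaussianNoise; infer_instance

lemma map_sum_gaussianNoise (σ : ℝ) (F : Finset NoiseIndex) :
    (gaussianNoise N σ).map (fun ω => ∑ i ∈ F, ω i) = isoGaussian N (F.card * σ ^ 2) := by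
  have hind : iIndepFun (fun (i : NoiseIndex) (ω : NoiseIndex → Vec N) => ω i)
      (gaussianNoise N σ) :=
    iIndepFun_infinitePi (X := fun _ x => x) fun _ => measurable_id
  apply Measure.ext_of_charFun
  rw [iIndepFun.charFun_map_fun_finsetSum_eq_prod (fun i _ =>
    (measurable_pi_apply i).aemeasurable) (hind.restrict F)]
  ext t
  have hmap : ∀ i : NoiseIndex, (gaussianNoise N σ).map (fun ω => ω i) = isoGaussian N (σ ^ 2) :=
    fun i => Measure.infinitePi_map_eval _ i
  simp only [hmap, Finset.prod_const, Pi.pow_apply]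
  rw [charFun_isoGaussian (by positivity), charFun_isoGaussian (by positivity),
    ← Complex.exp_nat_mul]
  congr 1
  push_cast
  ring

lemma gaussianShift_gaussianNoise {σ : ℝ} (hσ : 0 < σ) (F : Finset NoiseIndex) (a : Vec N) :
    GaussianShift (gaussianNoise N σ)
      ((gaussianNoise N σ).map fun ω i => ω i + if i ∈ F then a else 0)
      (F.card * (‖a‖ ^ 2 / σ ^ 2)) := by
  have hprob : ∀ b : Vec N, IsProbabilityMeasure ((isoGaussian N (σ ^ 2)).map (· + b)) :=
    fun b => Measure.isProbabilityMeasure_map (measurable_add_const b).aemeasurable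
  rw [gaussianNoise, Measure.infinitePi_map_pi (f := fun i x => x + if i ∈ F then a else 0) _
    (fun i => measurable_add_const _), ← nsmul_eq_mul, ← Finset.sum_const]
  refine GaussianShift.infinitePi _ _ F _ (fun i hi => ?_) (fun i hi => ?_)
  · simp only [hi, if_true]
    exact gaussianShift_isoGaussian a (by positivity)
  · simp [hi]

end Noise

/-! ### Numerical choice of the moment order -/

section PrivacyParameters

/-- The maximum of `(1 - e^{-u}) e^{-τ u}` is `τ^τ / (1 + τ)^(1 + τ)`, attained at `e^u = (1 + τ) /
τ`. Here `τ = 2`, hence `4 / 27` and the double root `3 / 2`; the next two lemmas round the maxima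
for `τ = 1 / 2` and `τ = 1 / 10` upwards. -/
lemma one_sub_exp_neg_le_two {u : ℝ} : 1 - Real.exp (-u) ≤ 4 / 27 * Real.exp (2 * u) := by
  have hy := Real.exp_pos u
  rw [Real.exp_neg, two_mul, Real.exp_add]
  set y := Real.exp u
  rw [sub_le_iff_le_add, ← mul_le_mul_iff_left₀ hy, add_mul, inv_mul_cancel₀ hy.ne']
  nlinarith [mul_nonneg (sq_nonneg (2 * y - 3)) (by positivity : 0 ≤ y + 3)]

lemma one_sub_exp_neg_le_half {u : ℝ} (hu : 0 ≤ u) :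
    1 - Real.exp (-u) ≤ 385 / 1000 * Real.exp (1 / 2 * u) := by
  have hy : 1 ≤ Real.exp (1 / 2 * u) := Real.one_le_exp (by positivity)
  rw [show -u = -(1 / 2 * u + 1 / 2 * u) by ring, Real.exp_neg, Real.exp_add]
  set y := Real.exp (1 / 2 * u)
  have hy2 : 0 < y * y := by positivity
  rw [sub_le_iff_le_add, ← mul_le_mul_iff_left₀ hy2, add_mul, inv_mul_cancel₀ hy2.ne']
  nlinarith [mul_nonneg (sq_nonneg (y - 1.732)) (by linarith : 0 ≤ y + 0.866)]

lemma one_sub_exp_neg_le_tenth {u : ℝ} :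
    1 - Real.exp (-u) ≤ 72 / 100 * Real.exp (1 / 10 * u) := by
  have hs := Real.exp_pos (-(1 / 10 * u))
  have e1 : Real.exp (-u) = Real.exp (-(1 / 10 * u)) ^ 10 := by
    rw [← Real.exp_nat_mul]; congr 1; push_cast; ring
  have e2 : Real.exp (1 / 10 * u) = (Real.exp (-(1 / 10 * u)))⁻¹ := by
    rw [← Real.exp_neg, neg_neg]
  have hs1 : Real.exp (-(1 / 10 * u)) ≤ 1 ∨ 1 < Real.exp (-(1 / 10 * u)) := le_or_gt _ _
  rw [e1, e2]
  set s := Real.exp (-(1 / 10 * u))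
  rw [← div_eq_mul_inv, le_div_iff₀ hs]
  rcases hs1 with hs1 | hs1
  -- Bernoulli's inequality is the tangent to `s ^ 11` at `0.787`, close to the maximiser `11 ^ (-1
  -- / 10)` of `s - s ^ 11`.
  · have hb := one_add_mul_le_pow (a := s / 0.787 - 1) (by
      have : 0 ≤ s / 0.787 := by positivity
      linarith) 11
    rw [show 1 + (s / 0.787 - 1) = s / 0.787 by ring, div_pow, le_div_iff₀ (by positivity)] at hb
    norm_num at hb
    nlinarith
  · nlinarith [one_le_pow₀ hs1.le (n := 10)]

/-- No single `τ` covers all `a`: it is taken to be `1 / 10` on `[0.65, 1]`, `1 / 2` on `[1, 2]` and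
`a` beyond. In `red`, `M` bounds the exponent after multiplication by `2 ^ a`, and `y` bounds `e^M`.
-/
lemma exists_exponent {a : ℝ} (ha : 0.65 ≤ a) :
    ∃ τ c : ℝ, 0 < τ ∧ 0 ≤ c ∧ (∀ u, 0 ≤ u → 1 - Real.exp (-u) ≤ c * Real.exp (τ * u)) ∧
      c * Real.exp (-τ + τ * (1 + τ) * (1.6 / a ^ 2)) ≤ 19 / 12 * Real.exp (-(a * Real.log 2)) := by
  have ha0 : 0 < a := by linarith
  have hlog := Real.log_two_lt_d9
  have red : ∀ c E M y : ℝ, 0 ≤ c → E + a * Real.log 2 ≤ M → Real.exp M ≤ y → c * y ≤ 19 / 12 →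
      c * Real.exp E ≤ 19 / 12 * Real.exp (-(a * Real.log 2)) := by
    intro c E M y hc h1 h2 h3
    have h4 : Real.exp E = Real.exp (E + a * Real.log 2) * Real.exp (-(a * Real.log 2)) := by
      rw [← Real.exp_add]; congr 1; ring
    rw [h4, ← mul_assoc]
    refine mul_le_mul_of_nonneg_right (le_trans ?_ h3) (Real.exp_pos _).le
    exact mul_le_mul_of_nonneg_left ((Real.exp_le_exp.2 h1).trans h2) hc
  have he := Real.exp_one_lt_d9
  rcases le_total a 1 with h1 | h1
  · refine ⟨1 / 10, 72 / 100, by norm_num, by norm_num, fun _ _ => one_sub_exp_neg_le_tenth, ?_⟩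
    refine red _ _ (77 / 100) 2.19 (by norm_num) ?_ ?_ (by norm_num)
    -- By convexity `1 / a ^ 2` lies below its chord, here on `[0.65, 1]` with slope rounded, and on
    -- `[1, 2]` in the next case.
    · have : 1.6 / a ^ 2 ≤ 1.6 * (1 + 3.906 * (1 - a)) := by
        rw [div_le_iff₀ (by positivity)]
        nlinarith [mul_nonneg (sub_nonneg.2 h1) (by nlinarith : 0 ≤ 3.906 * a ^ 2 - a - 1)]
      nlinarith
    · rw [← pow_le_pow_iff_left₀ (Real.exp_pos _).le (by norm_num) (n := 100) (by norm_num),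
        ← Real.exp_nat_mul, show ((100 : ℕ) : ℝ) * (77 / 100) = (77 : ℕ) * 1 by norm_num,
        Real.exp_nat_mul]
      exact (pow_le_pow_left₀ (Real.exp_pos 1).le (by linarith : Real.exp 1 ≤ 2.72) 77).trans
        (by norm_num)
  rcases le_total a 2 with h2 | h2
  · refine ⟨1 / 2, 385 / 1000, by norm_num, by norm_num, fun _ => one_sub_exp_neg_le_half, ?_⟩
    refine red _ _ (7 / 5) 4.1 (by norm_num) ?_ ?_ (by norm_num)
    · have : 1.6 / a ^ 2 ≤ 1.6 * (1 - 3 / 4 * (a - 1)) := by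
        rw [div_le_iff₀ (by positivity)]
        nlinarith [mul_nonneg (sub_nonneg.2 h1) (by nlinarith : 0 ≤ -(3 / 4) * a ^ 2 + a + 1)]
      nlinarith
    · rw [← pow_le_pow_iff_left₀ (Real.exp_pos _).le (by norm_num) (n := 5) (by norm_num),
        ← Real.exp_nat_mul, show ((5 : ℕ) : ℝ) * (7 / 5) = (7 : ℕ) * 1 by norm_num,
        Real.exp_nat_mul]
      exact (pow_le_pow_left₀ (Real.exp_pos 1).le (by linarith : Real.exp 1 ≤ 2.72) 7).trans
        (by norm_num)
  · refine ⟨a, 4 / 27, ha0, by norm_num, fun u hu => one_sub_exp_neg_le_two.trans ?_, ?_⟩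
    · gcongr
    refine red _ _ 2 7.5 (by norm_num) ?_ ?_ (by norm_num)
    · have e : a * (1 + a) * (1.6 / a ^ 2) = 1.6 / a + 1.6 := by field_simp
      have : 1.6 / a ≤ 0.8 := by rw [div_le_iff₀ ha0]; linarith
      nlinarith
    · rw [show (2 : ℝ) = (2 : ℕ) * 1 by norm_num, Real.exp_nat_mul]
      exact (pow_le_pow_left₀ (Real.exp_pos 1).le (by linarith : Real.exp 1 ≤ 2.72) 2).trans
        (by norm_num)

lemma le_logb_two_three : 19 / 12 ≤ Real.logb 2 3 := by
  rw [Real.le_logb_iff_rpow_le (by norm_num) (by norm_num),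
    ← pow_le_pow_iff_left₀ (by positivity) (by norm_num) (n := 12) (by norm_num),
    ← Real.rpow_natCast, ← Real.rpow_mul (by norm_num)]
  norm_num

lemma le_logb_two_of_three_le {T : ℕ} (hT : 3 ≤ T) : 19 / 12 ≤ Real.logb 2 T :=
  le_logb_two_three.trans
    (Real.logb_le_logb_of_le (by norm_num) (by norm_num) (by exact_mod_cast hT))

/-- The factor `1.6` is dictated by `T = 3`, where `4 ≤ 1.6 (19 / 12)²` barely holds; `T = 2` would
violate the bound. -/
lemma two_mul_ceil_logb_le {T : ℕ} (hT : 3 ≤ T) :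
    2 * (⌈Real.logb 2 T⌉₊ : ℝ) ≤ 1.6 * Real.logb 2 T ^ 2 := by
  have h1 := le_logb_two_of_three_le hT
  rcases hT.eq_or_lt with hT | hT
  · have : ⌈Real.logb 2 T⌉₊ ≤ 2 := by
      rw [Nat.ceil_le, Real.logb_le_iff_le_rpow (by norm_num) (by rw [← hT]; norm_num), ← hT]
      norm_num
    have : (⌈Real.logb 2 T⌉₊ : ℝ) ≤ 2 := by exact_mod_cast this
    nlinarith
  · have h2 : 2 ≤ Real.logb 2 T := by
      rw [Real.le_logb_iff_rpow_le (by norm_num) (by positivity)]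
      norm_num
      exact_mod_cast hT
    have := Nat.ceil_lt_add_one (by linarith : 0 ≤ Real.logb 2 T)
    nlinarith

lemma le_logb_div {x δ : ℝ} (hx : 19 / 12 ≤ x) (hδ : 0 < δ) (hδ1 : δ < 1) :
    0.65 ≤ Real.logb 2 (x / δ) := by
  have hxd : 19 / 12 ≤ x / δ := by
    rw [le_div_iff₀ hδ]; nlinarith
  rw [Real.le_logb_iff_rpow_le (by norm_num) (by linarith)]
  refine le_trans ?_ hxd
  rw [← pow_le_pow_iff_left₀ (by positivity) (by norm_num) (n := 20) (by norm_num),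
    ← Real.rpow_natCast, ← Real.rpow_mul (by norm_num),
    show (0.65 * ((20 : ℕ) : ℝ)) = (13 : ℕ) by norm_num, Real.rpow_natCast]
  norm_num

/-- The noise level of the algorithm is large enough for the Gaussian mechanism with
`⌈log₂ T⌉` queries of sensitivity `2`. -/
lemma exists_privacy_parameters {T : ℕ} (hT : 3 ≤ T) {ε δ r : ℝ} (hε : 0 < ε) (hε1 : ε ≤ 1)
    (hδ : 0 < δ) (hδ1 : δ < 1)
    (hr : r ≤ 4 * ⌈Real.logb 2 T⌉₊ *
      (ε / (Real.logb 2 T * Real.logb 2 (Real.logb 2 T / δ))) ^ 2) :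
    ∃ θ τ c : ℝ, 0 ≤ c ∧ τ ≤ θ ∧ (∀ u, 0 ≤ u → 1 - Real.exp (-u) ≤ c * Real.exp (τ * u)) ∧
      c * Real.exp (-θ * ε + θ * (1 + θ) * r / 2) ≤ δ := by
  have hx := le_logb_two_of_three_le hT
  have hm := two_mul_ceil_logb_le hT
  set x := Real.logb 2 T
  have ha := le_logb_div hx hδ hδ1
  have hx0 : 0 < x := by linarith
  -- That is, `δ = x 2 ^ (-a)` with `a = log (x / δ)`; the factor `x ≥ 19 / 12` is what
  -- `exists_exponent` leaves room for.
  have hδe : δ = x * Real.exp (-(Real.logb 2 (x / δ) * Real.log 2)) := by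
    rw [Real.exp_neg, mul_comm _ (Real.log 2), ← Real.rpow_def_of_pos (by norm_num),
      Real.rpow_logb (by norm_num) (by norm_num) (by positivity)]
    field_simp
  set a := Real.logb 2 (x / δ)
  have ha0 : 0 < a := by linarith
  obtain ⟨τ, c, hτ, hc, hu, hle⟩ := exists_exponent ha
  -- With `θ = τ / ε` the term `θ ε` is `τ`, and `ε ≤ 1` gives both `τ ≤ θ` and `ε + τ ≤ 1 + τ`.
  refine ⟨τ / ε, τ, c, hc, by rw [le_div_iff₀ hε]; nlinarith, hu, ?_⟩
  rw [hδe]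
  refine le_trans ?_ (hle.trans (mul_le_mul_of_nonneg_right hx (Real.exp_pos _).le))
  gcongr
  · field_simp; rfl
  · have hr2 : r / 2 ≤ ε ^ 2 * (1.6 / a ^ 2) := by
      have : r ≤ 2 * (1.6 * x ^ 2) * (ε / (x * a)) ^ 2 := by
        refine hr.trans (mul_le_mul_of_nonneg_right (by linarith) (sq_nonneg _))
      have e : 2 * (1.6 * x ^ 2) * (ε / (x * a)) ^ 2 = 2 * (ε ^ 2 * (1.6 / a ^ 2)) := by
        field_simp
      linarith
    calc τ / ε * (1 + τ / ε) * r / 2 = τ / ε * (1 + τ / ε) * (r / 2) := by ring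
      _ ≤ τ / ε * (1 + τ / ε) * (ε ^ 2 * (1.6 / a ^ 2)) := by gcongr
      _ = τ * (ε + τ) * (1.6 / a ^ 2) := by field_simp
      _ ≤ τ * (1 + τ) * (1.6 / a ^ 2) := by gcongr

end PrivacyParameters

/-! ### Privacy of the algorithm, and the leader that looks one loss ahead -/

section Oracle

variable {N T : ℕ} {X Y : Set (Vec N)} {oracle : Vec N → Vec N}

lemma norm_le_setNorm (hY : Bornology.IsBounded Y) {y : Vec N} (hy : y ∈ Y) :
    ‖y‖ ≤ setNorm Y := by
  obtain ⟨R, hR⟩ := hY.exists_norm_le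
  exact le_csSup ⟨R, by rintro _ ⟨z, hz, rfl⟩; exact hR z hz⟩ ⟨y, hy, rfl⟩

lemma setNorm_nonneg (S : Set (Vec N)) : 0 ≤ setNorm S :=
  Real.sSup_nonneg (by rintro _ ⟨z, -, rfl⟩; exact norm_nonneg z)

lemma measurable_treeAgg (l : Fin T → Vec N) (t : ℕ) :
    Measurable fun ω : NoiseIndex → Vec N => treeAgg l ω t := by
  simp_rw [treeAgg_eq]
  fun_prop

lemma measurable_ftpl (ho : Measurable oracle) (l : Fin T → Vec N) :
    Measurable (ftpl oracle l) :=
  measurable_pi_lambda _ fun t => ho.comp (measurable_treeAgg l t)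

/-- Tree-based follow-the-perturbed-leader is differentially private if the noise is as large as
the Gaussian mechanism requires. -/
theorem isDifferentiallyPrivate_ftpl (ho : Measurable oracle) (hY : Bornology.IsBounded Y)
    {ε δ σ : ℝ} (hT : 3 ≤ T) (hε : 0 < ε) (hε1 : ε ≤ 1) (hδ : 0 < δ) (hδ1 : δ < 1) (hσ : 0 < σ)
    (h : setNorm Y / ε * Real.logb 2 T * Real.logb 2 (Real.logb 2 T / δ) ≤ σ) :
    IsDifferentiallyPrivate (gaussianNoise N σ) Y (ftpl (T := T) oracle) ε δ := by
  intro l l' hl hl' ⟨t₀, ht₀⟩ S hS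
  set m := ⌈Real.logb 2 T⌉₊ with hm
  set a := l t₀ - l' t₀ with ha
  have hx := le_logb_two_of_three_le hT
  have hD := le_logb_div hx hδ hδ1
  set x := Real.logb 2 T
  set D := Real.logb 2 (x / δ)
  have hxD : 0 < x * D := by nlinarith
  have hY0 := setNorm_nonneg Y
  have hYσ : setNorm Y / σ ≤ ε / (x * D) := by
    rw [div_le_div_iff₀ hσ hxD]
    have : setNorm Y / ε * x * D = setNorm Y * (x * D) / ε := by ring
    rw [this, div_le_iff₀ hε] at h
    linarith
  have ha2 : ‖a‖ ≤ 2 * setNorm Y := by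
    have h1 := norm_le_setNorm hY (hl t₀)
    have h2 := norm_le_setNorm hY (hl' t₀)
    have := norm_sub_le (l t₀) (l' t₀)
    linarith
  have hshift := gaussianShift_gaussianNoise hσ (ancestors m t₀) a
  have hr : (ancestors m t₀).card * (‖a‖ ^ 2 / σ ^ 2) ≤ 4 * m * (ε / (x * D)) ^ 2 := by
    calc ((ancestors m t₀).card : ℝ) * (‖a‖ ^ 2 / σ ^ 2)
        ≤ m * ((2 * setNorm Y) ^ 2 / σ ^ 2) := by
          gcongr
          exact card_ancestors_le m t₀
      _ = 4 * m * (setNorm Y / σ) ^ 2 := by ring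
      _ ≤ 4 * m * (ε / (x * D)) ^ 2 := by gcongr
  obtain ⟨θ, τ, c, hc, hτ, hu, hle⟩ := exists_privacy_parameters hT hε hε1 hδ hδ1 hr
  have hB := measurable_ftpl ho l' hS
  have hmain := hshift.measure_le (ε := ε) hc hτ hu hB
  have hmeas : Measurable fun (ω : NoiseIndex → Vec N) (i : NoiseIndex) =>
      ω i + if i ∈ ancestors m t₀ then a else 0 := by fun_prop
  rw [Measure.map_apply hmeas hB] at hmain
  have hset : {ω | ftpl oracle l ω ∈ S} = (fun (ω : NoiseIndex → Vec N) (i : NoiseIndex) =>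
      ω i + if i ∈ ancestors m t₀ then a else 0) ⁻¹' (ftpl oracle l' ⁻¹' S) := by
    ext ω
    rw [Set.mem_ofPred_eq, ftpl_eq_shift oracle ht₀ ω]
    rfl
  rw [hset]
  exact hmain.trans (add_le_add le_rfl (ENNReal.ofReal_le_ofReal hle))

/-- The leader which knows the next loss has regret at most `2 ‖X‖ ‖z‖`, where `z` is the
perturbation. -/
lemma sum_be_the_leader_le (hX : Bornology.IsBounded X) (ho : IsArgminOracle X oracle)
    (l : Fin T → Vec N) (z : Vec N) :
    ∑ t : Fin T, inner ℝ (l t) (oracle (prefixSum l (t + 1) + z)) ≤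
      sInf ((fun y => ∑ t, inner ℝ (l t) y) '' X) + 2 * setNorm X * ‖z‖ := by
  -- For `Φ v = min ⟨x, v⟩`, the minimiser at the later argument is only a competitor at the earlier
  -- one; the increments of `Φ` telescope from `Φ z` to `Φ (∑ l + z)`.
  have hstep : ∀ t : Fin T, inner ℝ (l t) (oracle (prefixSum l (t + 1) + z)) ≤
      inner ℝ (oracle (prefixSum l (t + 1) + z)) (prefixSum l (t + 1) + z) -
        inner ℝ (oracle (prefixSum l t + z)) (prefixSum l t + z) := by
    intro t
    have h1 := ho.le (prefixSum l t + z) _ (ho.mem (prefixSum l (t + 1) + z))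
    rw [real_inner_comm]
    generalize oracle (prefixSum l (t + 1) + z) = x at h1 ⊢
    rw [prefixSum_succ, add_right_comm, inner_add_right x _ (l t)]
    linarith
  have hsum := Finset.sum_le_sum fun t (_ : t ∈ Finset.univ) => hstep t
  have htel := Finset.sum_range_sub
    (fun t => (inner ℝ (oracle (prefixSum l t + z)) (prefixSum l t + z) : ℝ)) T
  rw [← Fin.sum_univ_eq_sum_range (fun t =>
    (inner ℝ (oracle (prefixSum l (t + 1) + z)) (prefixSum l (t + 1) + z) : ℝ) -
      inner ℝ (oracle (prefixSum l t + z)) (prefixSum l t + z)) T] at htel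
  rw [htel, prefixSum_zero, zero_add, prefixSum_self] at hsum
  rw [← sub_le_iff_le_add]
  refine le_csInf ⟨_, oracle 0, ho.mem 0, rfl⟩ ?_
  rintro _ ⟨y, hy, rfl⟩
  have h1 := ho.le (∑ t, l t + z) y hy
  rw [inner_add_right y] at h1
  have h2 : (inner ℝ y z : ℝ) ≤ setNorm X * ‖z‖ := (real_inner_le_norm _ _).trans
    (mul_le_mul_of_nonneg_right (norm_le_setNorm hX hy) (norm_nonneg _))
  have h3 : -(setNorm X * ‖z‖) ≤ (inner ℝ (oracle z) z : ℝ) :=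
    neg_le_of_abs_le ((abs_real_inner_le_norm _ _).trans
      (mul_le_mul_of_nonneg_right (norm_le_setNorm hX (ho.mem z)) (norm_nonneg _)))
  simp only [← sum_inner]
  rw [real_inner_comm y]
  linarith

end Oracle

/-! ### Expected regret for a general noise level -/

section Regret

variable {N T : ℕ} {X Y : Set (Vec N)} {oracle : Vec N → Vec N}

lemma abs_inner_oracle_le (hX : Bornology.IsBounded X) (ho : IsArgminOracle X oracle)
    (u v : Vec N) : |(inner ℝ u (oracle v) : ℝ)| ≤ ‖u‖ * setNorm X :=
  (abs_real_inner_le_norm _ _).trans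
    (mul_le_mul_of_nonneg_left (norm_le_setNorm hX (ho.mem v)) (norm_nonneg _))

lemma measurable_inner_oracle (ho : IsArgminOracle X oracle) (u p : Vec N) :
    Measurable fun z => (inner ℝ u (oracle (p + z)) : ℝ) :=
  measurable_const.inner (ho.measurable.comp (measurable_const_add p))

lemma integrable_inner_oracle (hX : Bornology.IsBounded X) (ho : IsArgminOracle X oracle)
    {Ω : Type*} [MeasurableSpace Ω] (P : Measure Ω) [IsProbabilityMeasure P] {f : Ω → Vec N}
    (hf : Measurable f) (u : Vec N) : Integrable (fun ω => (inner ℝ u (oracle (f ω)) : ℝ)) P :=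
  Integrable.of_bound (measurable_const.inner (ho.measurable.comp hf)).aestronglyMeasurable
    (‖u‖ * setNorm X) (Filter.Eventually.of_forall fun ω => abs_inner_oracle_le hX ho u (f ω))

lemma integrable_realizedRegret (hX : Bornology.IsBounded X) (ho : IsArgminOracle X oracle)
    (l : Fin T → Vec N) (σ : ℝ) :
    Integrable (fun ω => realizedRegret X l (ftpl oracle l ω)) (gaussianNoise N σ) :=
  (integrable_finsetSum _ fun (t : Fin T) _ => integrable_inner_oracle hX ho _
    (measurable_treeAgg l t) (l t)).sub (integrable_const _)

/-- The predictions are stable: a shift of the cumulated loss by `u` changes the expected loss of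
the perturbed leader by at most a multiple of `‖u‖`. -/
lemma integral_inner_oracle_sub_le (hX : Bornology.IsBounded X) (ho : IsArgminOracle X oracle)
    {v : ℝ} (hv : 0 < v) (p u : Vec N) :
    ∫ z, (inner ℝ u (oracle (p + z)) : ℝ) ∂(isoGaussian N v) -
      ∫ z, (inner ℝ u (oracle (p + u + z)) : ℝ) ∂(isoGaussian N v) ≤
      2 * setNorm X * ‖u‖ ^ 2 / √v := by
  have h := (gaussianShift_isoGaussian u hv).abs_integral_sub_le (by positivity)
    (measurable_inner_oracle ho u p) (fun z => abs_inner_oracle_le hX ho u (p + z))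
  rw [integral_map (measurable_add_const u).aemeasurable
    (measurable_inner_oracle ho u p).aestronglyMeasurable, abs_sub_comm] at h
  simp_rw [add_assoc p u, add_comm u]
  refine (le_abs_self _).trans (h.trans_eq ?_)
  rw [Real.sqrt_div (sq_nonneg _), Real.sqrt_sq (norm_nonneg _)]
  ring

lemma integral_realizedRegret_le (hX : Bornology.IsBounded X) (ho : IsArgminOracle X oracle)
    (hY : Bornology.IsBounded Y) {l : Fin T → Vec N} (hl : ∀ t, l t ∈ Y) {σ v : ℝ} (hv : 0 < v)
    (hσv : v = ⌈Real.logb 2 T⌉₊ * σ ^ 2) :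
    ∫ ω, realizedRegret X l (ftpl oracle l ω) ∂(gaussianNoise N σ) ≤
      T * (2 * setNorm X * setNorm Y ^ 2 / √v) + 2 * setNorm X * √(N * v) := by
  have hX0 := setNorm_nonneg X
  set I := sInf ((fun y => ∑ t, (inner ℝ (l t) y : ℝ)) '' X) with hI
  -- Only the law of the noise in round `t` matters here, so correlations between rounds disappear.
  have hround : ∀ t : Fin T, ∫ ω, (inner ℝ (l t) (oracle (treeAgg l ω t)) : ℝ) ∂(gaussianNoise N σ) =
      ∫ z, (inner ℝ (l t) (oracle (prefixSum l t + z)) : ℝ) ∂(isoGaussian N v) := by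
    intro t
    rw [hσv, ← card_noiseIndices t.2, ← map_sum_gaussianNoise, integral_map (by fun_prop)
      (measurable_inner_oracle ho _ _).aestronglyMeasurable]
    simp_rw [treeAgg_eq]
  have hint : ∀ (t : Fin T) (p : Vec N),
      Integrable (fun z => (inner ℝ (l t) (oracle (p + z)) : ℝ)) (isoGaussian N v) :=
    fun t p => integrable_inner_oracle hX ho _ (measurable_const_add p) (l t)
  have hnorm : Integrable (fun z : Vec N => ‖z‖) (isoGaussian N v) :=
    ((memLp_two_isoGaussian v).integrable (by norm_num)).norm
  have hstab : ∀ t : Fin T,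
      ∫ z, (inner ℝ (l t) (oracle (prefixSum l t + z)) : ℝ) ∂(isoGaussian N v) ≤
      ∫ z, (inner ℝ (l t) (oracle (prefixSum l (t + 1) + z)) : ℝ) ∂(isoGaussian N v) +
        2 * setNorm X * setNorm Y ^ 2 / √v := by
    intro t
    have h := integral_inner_oracle_sub_le hX ho hv (prefixSum l t) (l t)
    have h2 : 2 * setNorm X * ‖l t‖ ^ 2 / √v ≤ 2 * setNorm X * setNorm Y ^ 2 / √v := by
      gcongr
      exact norm_le_setNorm hY (hl t)
    rw [prefixSum_succ]
    linarith
  have hleader : ∑ t : Fin T, ∫ z, (inner ℝ (l t) (oracle (prefixSum l (t + 1) + z)) : ℝ)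
      ∂(isoGaussian N v) ≤ I + 2 * setNorm X * √(N * v) := by
    rw [← integral_finsetSum _ fun t _ => hint t _]
    calc _ ≤ ∫ z, (I + 2 * setNorm X * ‖z‖) ∂(isoGaussian N v) :=
          integral_mono (integrable_finsetSum _ fun t _ => hint t _)
            ((integrable_const _).add (hnorm.const_mul _)) fun z => sum_be_the_leader_le hX ho l z
      _ = I + 2 * setNorm X * ∫ z, ‖z‖ ∂(isoGaussian N v) := by
          rw [integral_add (integrable_const _) (hnorm.const_mul _), integral_const_mul]
          simp
      _ ≤ _ := by
          gcongr
          exact integral_norm_isoGaussian_le hv.le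
  have hsum := Finset.sum_le_sum fun t (_ : t ∈ Finset.univ) => hstab t
  rw [Finset.sum_add_distrib] at hsum
  simp only [Finset.sum_const, Finset.card_univ, Fintype.card_fin, nsmul_eq_mul] at hsum
  simp only [realizedRegret, ftpl, ← hI]
  rw [integral_sub (integrable_finsetSum _ fun (t : Fin T) _ => integrable_inner_oracle hX ho _
    (measurable_treeAgg l t) (l t)) (integrable_const _), integral_finsetSum _ fun (t : Fin T) _ =>
    integrable_inner_oracle hX ho _ (measurable_treeAgg l t) (l t)]
  simp_rw [hround]
  simp only [integral_const, probReal_univ, one_smul]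
  linarith

end Regret

/-! ### Substituting the noise level -/

section Scale

variable {N T : ℕ}

lemma one_le_logb_two (hT : 2 ≤ T) : 1 ≤ Real.logb 2 T := by
  rw [Real.le_logb_iff_rpow_le (by norm_num) (by positivity), Real.rpow_one]
  exact_mod_cast hT

lemma logb_logb_div_pos (hT : 2 ≤ T) {δ : ℝ} (hδ : 0 < δ) (hδ1 : δ < 1) :
    0 < Real.logb 2 (Real.logb 2 T / δ) := by
  refine Real.logb_pos (by norm_num) ?_
  rw [lt_div_iff₀ hδ]
  linarith [one_le_logb_two hT]

lemma noiseScale_pos (hN : 1 ≤ N) (hT : 2 ≤ T) (Y : Set (Vec N)) {ε δ : ℝ} (hε : 0 < ε)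
    (hδ : 0 < δ) (hδ1 : δ < 1) : 0 < noiseScale N T Y ε δ := by
  have h1 := one_le_logb_two hT
  have h2 := logb_logb_div_pos hT hδ hδ1
  have : 0 < √(N : ℝ) := Real.sqrt_pos.2 (by exact_mod_cast hN)
  exact lt_max_of_lt_right (by positivity)

/-- The choice of the noise level balances the two parts of the regret. -/
lemma regret_bound_noiseScale (hN : 1 ≤ N) (hT : 2 ≤ T) {y x lam D ε σ m : ℝ} (hy : 0 ≤ y)
    (hx : 0 ≤ x) (hlam : 1 ≤ lam) (hD : 0 < D) (hε : 0 < ε) (hm : lam ≤ m) (hm' : m ≤ 4 * lam)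
    (hσ : σ = max (y * √(T / (√N * lam))) (√N / ε * lam * D)) (hσ0 : 0 < σ) :
    T * (2 * x * y ^ 2 / √(m * σ ^ 2)) + 2 * x * √(N * (m * σ ^ 2)) ≤
      6 * ((N : ℝ) ^ (1 / 4 : ℝ) * x * y * √T + N * x / ε * lam ^ (3 / 2 : ℝ) * D) := by
  -- In terms of `q`, `s = √lam` and `R = √T` all fractional powers become monomials. The stability
  -- term uses `σ` above the first entry of the maximum, the perturbation term uses the maximum
  -- below the sum.
  set q := (N : ℝ) ^ (1 / 4 : ℝ) with hq
  set s := √lam with hs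
  set R := √(T : ℝ) with hR
  have hN0 : (0 : ℝ) < N := by exact_mod_cast hN
  have hT0 : (0 : ℝ) < T := by positivity
  have hq0 : 0 < q := by positivity
  have hs0 : 0 < s := Real.sqrt_pos.2 (by linarith)
  have hR0 : 0 < R := Real.sqrt_pos.2 hT0
  have hqN : √(N : ℝ) = q ^ 2 := by
    rw [Real.sqrt_eq_rpow, hq, ← Real.rpow_natCast, ← Real.rpow_mul hN0.le]; norm_num
  have hNq : (N : ℝ) = q ^ 4 := by
    rw [hq, ← Real.rpow_natCast, ← Real.rpow_mul hN0.le]; norm_num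
  have hls : lam = s ^ 2 := (Real.sq_sqrt (by linarith)).symm
  have hTR : (T : ℝ) = R ^ 2 := (Real.sq_sqrt hT0.le).symm
  have hl3 : lam ^ (3 / 2 : ℝ) = s ^ 3 := by
    rw [hs, Real.sqrt_eq_rpow, ← Real.rpow_natCast, ← Real.rpow_mul (by linarith)]; norm_num
  have hroot : √(T / (√N * lam)) = R / (q * s) := by
    rw [hqN, hls, hTR, ← mul_pow, ← div_pow, Real.sqrt_sq (by positivity)]
  have hm0 : 0 < m := by linarith
  have hsm : s ≤ √m := Real.sqrt_le_sqrt hm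
  have hms : √m ≤ 2 * s := by
    rw [Real.sqrt_le_left (by positivity), mul_pow, ← hls]; linarith
  have hmσ : √(m * σ ^ 2) = √m * σ := by rw [Real.sqrt_mul hm0.le, Real.sqrt_sq hσ0.le]
  rw [Real.sqrt_mul hN0.le, hmσ, hqN, hl3]
  rw [hroot, hqN] at hσ
  have hσ1 : y * (R / (q * s)) ≤ σ := hσ ▸ le_max_left _ _
  have hσ2 : σ ≤ y * (R / (q * s)) + q ^ 2 / ε * lam * D := by
    rw [hσ]
    exact max_le_add_of_nonneg (by positivity) (by positivity)
  have first : T * (2 * x * y ^ 2 / (√m * σ)) ≤ 2 * (q * x * y * R) := by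
    rw [← mul_div_assoc, div_le_iff₀ (by positivity)]
    have h1 : y * R ≤ σ * (q * s) := by
      have := mul_le_mul_of_nonneg_right hσ1 (by positivity : 0 ≤ q * s)
      rwa [mul_assoc, div_mul_cancel₀ _ (by positivity)] at this
    have h2 : σ * (q * s) ≤ σ * (q * √m) := by gcongr
    calc T * (2 * x * y ^ 2) = 2 * (x * y * R) * (y * R) := by rw [hTR]; ring
      _ ≤ 2 * (x * y * R) * (σ * (q * √m)) := by
          exact mul_le_mul_of_nonneg_left (h1.trans h2) (by positivity)
      _ = 2 * (q * x * y * R) * (√m * σ) := by ring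
  have second : 2 * x * (q ^ 2 * (√m * σ)) ≤
      4 * (q * x * y * R) + 4 * (N * x / ε * s ^ 3 * D) := by
    calc 2 * x * (q ^ 2 * (√m * σ))
        ≤ 2 * x * (q ^ 2 * (2 * s * (y * (R / (q * s)) + q ^ 2 / ε * lam * D))) := by gcongr
      _ = 4 * (q * x * y * R) + 4 * (N * x / ε * s ^ 3 * D) := by
          rw [hls, hNq]; field_simp; ring
  have : 0 ≤ N * x / ε * s ^ 3 * D := by positivity
  linarith

end Scale

end DPOnline

open DPOnline in
theorem theorem3p4 :
    ∃ C : ℝ, 0 < C ∧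
      ∀ (N T : ℕ), 1 ≤ N → 2 ≤ T →
      ∀ (X Y : Set (Vec N)), IsCompact X → Convex ℝ X → Bornology.IsBounded Y →
      ∀ (oracle : Vec N → Vec N), IsArgminOracle X oracle →
      ∀ (ε δ σ : ℝ), 0 < ε → 0 < δ → δ < 1 → σ = noiseScale N T Y ε δ →
        (∀ l : Fin T → Vec N, (∀ t, l t ∈ Y) →
          Integrable (fun ω => realizedRegret X l (ftpl oracle l ω)) (gaussianNoise N σ) ∧
          ∫ ω, realizedRegret X l (ftpl oracle l ω) ∂(gaussianNoise N σ) ≤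
            C * ((N : ℝ) ^ (1 / 4 : ℝ) * setNorm X * setNorm Y * √T +
              N * setNorm X / ε * Real.logb 2 T ^ (3 / 2 : ℝ) *
                Real.logb 2 (Real.logb 2 T / δ))) ∧
        (3 ≤ T → ε ≤ 1 →
          (setNorm Y ≤ √N ∨
            setNorm Y / ε * Real.logb 2 T * Real.logb 2 (Real.logb 2 T / δ) ≤ σ) →
          IsDifferentiallyPrivate (gaussianNoise N σ) Y (ftpl (T := T) oracle) ε δ) := by
  -- `6 = 2 + 4`: stability contributes `2` and the perturbation `4` to the `√T` term.
  refine ⟨6, by norm_num, ?_⟩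
  intro N T hN hT X Y hXc _ hY oracle ho ε δ σ hε hδ hδ1 hσ
  have hσ0 : 0 < σ := hσ ▸ noiseScale_pos hN hT Y hε hδ hδ1
  have hlam := one_le_logb_two hT
  have hD := logb_logb_div_pos hT hδ hδ1
  refine ⟨fun l hl => ⟨integrable_realizedRegret hXc.isBounded ho l σ, ?_⟩, fun hT3 hε1 h => ?_⟩
  · have hm := Nat.le_ceil (Real.logb 2 T)
    have hm' := Nat.ceil_lt_add_one (by linarith : 0 ≤ Real.logb 2 T)
    refine (integral_realizedRegret_le hXc.isBounded ho hY hl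
      (mul_pos (by linarith) (pow_pos hσ0 2)) rfl).trans ?_
    exact regret_bound_noiseScale hN hT (setNorm_nonneg Y) (setNorm_nonneg X) hlam hD hε hm
      (by linarith) hσ hσ0
  · refine isDifferentiallyPrivate_ftpl ho.measurable hY hT3 hε hε1 hδ hδ1 hσ0 (h.elim ?_ id)
    intro hYN
    -- If `‖Y‖ ≤ √N`, the second entry of the maximum defining `σ` already dominates the required
    -- noise.
    refine le_trans ?_ (hσ ▸ le_max_right _ _ :
      √N / ε * Real.logb 2 T * Real.logb 2 (Real.logb 2 T / δ) ≤ σ)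
    gcongr
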